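/- Let $q$ be an odd prime power, $A=\mathbb{F}_q[t]$, $k=\mathbb{F}_q(t)$ and $k_\infty=\mathbb{F}_q((1/t))$, with absolute value $\left|\sum_{i\le n}a_it^i\right|_\infty=q^n$ if $a_n\neq 0$ (and $|0|_\infty=0$), and with the additive character $$e\Big(\sum_{i\le n} a_it^i\Big)=\exp\Big(\frac{2\pi i}{p}\operatorname{Tr}_{\mathbb{F}_q/\mathbb{F}_p}(a_{-1})\Big),$$ where $p$ is the characteristic of $\mathbb{F}_q$. Let $\alpha\in A$ be a square-free polynomial which is of odd degree or whose leading coefficient is not a square in $\mathbb{F}_q$, let $K=k(\sqrt{\alpha})$, let $\mathbf{Tr}:K\to k$ be the trace, and let $\mathbb{A}=A+A\sqrt{\alpha}$ be the integral closure of $A$ in $K$. Denote by $|\cdot|_\infty$ also the (unique) extension of $|\cdot|_\infty$ from $k$ to $K$, and put $\mathbf{N}(x)=|x|_\infty^2$ for $x\in K$. Then there is a constant $C>0$ depending only on $q$ and $\deg\alpha$ such that for all integers $Q,N\ge 0$ and all complex numbers $(a_g)_{g\in\mathbb{A}}$, $$\sum_{\substack{f\in\mathbb{A}\setminus\{0\}\\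 \mathbf{N}(f)=q^Q}}\ \sum_{\substack{r \bmod f\\ (r,f)=1}}\ \Bigg|\sum_{\substack{g\in\mathbb{A}\\ \mathbf{N}(g)\le q^N}}a_g\, e\Big(\mathbf{Tr}\Big(\frac{gr}{2\sqrt{\alpha}\,f}\Big)\Big)\Bigg|^2\le C\,\big(q^{2Q}+q^N\big)\sum_{\substack{g\in\mathbb{A}\\ \mathbf{N}(g)\le q^N}}|a_g|^2 ,$$ where $r$ runs over any set of representatives of the residue classes modulo $f$ whose ideal $(r)$ is coprime to $(f)$; all the sums are finite. -/

import Mathlib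

/-!
The sum over `r mod f` is a sum over the characters `g ↦ e(Tr(g r / (2 √α f)))` of the finite
additive group `H = {g ∈ 𝔸 : N(g) ≤ q ^ N'}`, where `N' ≥ N` is at least `2 Q + 3 deg α`. Summed
over all the characters of `H`, the squares `|∑ a_g ψ(g)|²` give `|H| ∑ |a_g|²` by orthogonality,
and `|H| ≤ q ^ (deg α + N' + 2)` because `g` is determined by the polynomials `Tr g` and
`Tr (g √α)`, whose degrees are bounded. So it suffices that each character of `H` comes from a
bounded number of fractions.

Because `α` has odd degree or a leading coefficient that is not a square, the leading terms of
`x² - α y²` cannot cancel, and `|x + y √α| = max(|x|, |y √α|)`. Nonzero elements of `𝔸` therefore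
have absolute value at least `1`: otherwise the polynomials `Tr g` and `Tr (g²)` would vanish. If
`r / f` and `r' / f'` give the same character of `H`, then testing it on `c t ^ j` and on
`c t ^ j √α` shows that `r / f - r' / f'` is so close to some `w ∈ 𝔸` that the element
`r f' - r' f - w f f'` of `𝔸` must vanish. For reduced fractions this makes `f' / f` an element of
`𝔸` of absolute value `1`, of which there are boundedly many, and for `f = f'` it gives `r = r'`.
-/

open scoped Polynomial

noncomputable section

namespace QuadLargeSieve

/-- `k_∞ = F((1/t))`: Laurent series in the variable `1/t` over `F`. The coefficient of `t ^ i` of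
`x` is `x.coeff (-i)`. -/
abbrev KInf (F : Type*) [Field F] : Type _ := LaurentSeries F

/-- The element `t` of `k_∞ = F((1/t))`. -/
def tInf (F : Type*) [Field F] : KInf F := HahnSeries.single (-1 : ℤ) (1 : F)

theorem tInf_pow (F : Type*) [Field F] (n : ℕ) :
    tInf F ^ n = HahnSeries.single (-(n : ℤ)) (1 : F) := by
  rw [tInf, HahnSeries.single_pow]
  simp

/-- The embedding of `A = F[t]` into `k_∞ = F((1/t))`. -/
def polyToKInf (F : Type*) [Field F] : F[X] →+* KInf F :=
  Polynomial.eval₂RingHom (HahnSeries.C : F →+* HahnSeries ℤ F) (tInf F)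

theorem coeff_polyToKInf (F : Type*) [Field F] (f : F[X]) (n : ℕ) :
    (polyToKInf F f).coeff (-(n : ℤ)) = f.coeff n := by
  induction f using Polynomial.induction_on' with
  | add p q hp hq => rw [map_add, HahnSeries.coeff_add, hp, hq, Polynomial.coeff_add]
  | monomial m a =>
    have h1 : polyToKInf F (Polynomial.monomial m a) = HahnSeries.single (-(m : ℤ)) a := by
      rw [polyToKInf, Polynomial.coe_eval₂RingHom, Polynomial.eval₂_monomial, tInf_pow,
        HahnSeries.C_apply, HahnSeries.single_mul_single, zero_add, mul_one]
    rw [h1, HahnSeries.coeff_single, Polynomial.coeff_monomial]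
    by_cases h : m = n
    · simp [h]
    · have h' : n ≠ m := fun h' => h h'.symm
      simp [h, h']

theorem polyToKInf_injective (F : Type*) [Field F] : Function.Injective (polyToKInf F) := by
  intro f g h
  ext n
  rw [← coeff_polyToKInf, ← coeff_polyToKInf, h]

/-- The embedding of `k = F(t)` into `k_∞ = F((1/t))`: the field homomorphism that is the identity
on `F` and sends `t` to `t`. -/
def toKInf (F : Type*) [Field F] : RatFunc F →+* KInf F :=
  IsFractionRing.lift (A := F[X]) (K := RatFunc F) (polyToKInf_injective F)

/-- The absolute value on `k_∞`: it is `q ^ n` at `∑_{i ≤ n} a_i t ^ i` with `a_n ≠ 0`, where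
`q` is the number of elements of `F`, and `0` at `0`. -/
def absInf (F : Type*) [Field F] (x : KInf F) : ℝ :=
  open Classical in if x = 0 then 0 else (Nat.card F : ℝ) ^ (-x.order)

/-- The additive character `E(x) = exp((2πi/p) Tr(x))` of the finite field `F` of characteristic
`p`, with `Tr : F → 𝔽_p` the absolute trace. -/
def charE (F : Type*) [Field F] (x : F) : ℂ :=
  letI : Algebra (ZMod (ringChar F)) F := ZMod.algebra F (ringChar F)
  Complex.exp (2 * Real.pi * Complex.I / (ringChar F : ℂ) *
    ((Algebra.trace (ZMod (ringChar F)) F x).val : ℂ))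

/-- The additive character `e(∑ a_i t ^ i) = E(a_{-1})` of `k_∞`. -/
def charInf (F : Type*) [Field F] (x : KInf F) : ℂ := charE F (x.coeff 1)

section Quadratic

variable (F : Type*) [Field F] (K : Type*) [Field K] [Algebra F[X] K]

/-- The ring of integers `𝔸` of `K`: the integral closure of `A = F[t]` in `K`. -/
abbrev Integers : Type _ := integralClosure F[X] K

variable {F K}

/-- `N(x) = |x|_∞ ^ 2`, where `v = |·|_∞`. -/
def sizeN (v : AbsoluteValue K ℝ) (x : K) : ℝ := v x ^ 2

variable (F)

/-- The set of moduli `{f ∈ 𝔸 ∖ {0} : N(f) = q ^ Q}`. -/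
def moduli (v : AbsoluteValue K ℝ) (Q : ℕ) : Set (Integers F K) :=
  {f | f ≠ 0 ∧ sizeN v (f : K) = (Nat.card F : ℝ) ^ Q}

/-- The set `B(0, N) ∩ 𝔸 = {g ∈ 𝔸 : N(g) ≤ q ^ N}`. -/
def ballInt (v : AbsoluteValue K ℝ) (N : ℕ) : Set (Integers F K) :=
  {g | sizeN v (g : K) ≤ (Nat.card F : ℝ) ^ N}

end Quadratic

/-- `S` is a set of representatives of the residue classes `r mod f` with `(r, f) = 1`, the
coprimality being that of the ideals `(r)` and `(f)`. -/
def IsReducedResidueSystem {R : Type*} [CommRing R] (f : R) (S : Set R) : Prop :=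
  (∀ r ∈ S, IsCoprime r f) ∧ ∀ x : R, IsCoprime x f → ∃! r, r ∈ S ∧ f ∣ x - r

end QuadLargeSieve

end

namespace QuadLargeSieve

section FiniteFieldCharacter

variable (F : Type*) [Field F] [Finite F]

/-- The character `charE` as a bundled additive character: the standard character of `𝔽_p` composed
with the trace. -/
noncomputable def addCharE : AddChar F ℂ :=
  letI : Algebra (ZMod (ringChar F)) F := ZMod.algebra F (ringChar F)
  haveI : NeZero (ringChar F) := ⟨CharP.ringChar_ne_zero_of_finite F⟩
  (ZMod.stdAddChar (N := ringChar F)).compAddMonoidHom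
    (Algebra.trace (ZMod (ringChar F)) F).toAddMonoidHom

variable {F}

theorem addCharE_apply (x : F) : addCharE F x = charE F x := by
  have : NeZero (ringChar F) := ⟨CharP.ringChar_ne_zero_of_finite F⟩
  rw [addCharE, AddChar.compAddMonoidHom_apply, ZMod.stdAddChar_apply, ZMod.toCircle_apply, charE]
  congr 1
  simp only [LinearMap.toAddMonoidHom_coe]
  ring

theorem isPrimitive_addCharE : (addCharE F).IsPrimitive := by
  let _ : Algebra (ZMod (ringChar F)) F := ZMod.algebra F (ringChar F)
  have : NeZero (ringChar F) := ⟨CharP.ringChar_ne_zero_of_finite F⟩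
  obtain ⟨b, hb⟩ := FiniteField.trace_to_zmod_nondegenerate F (one_ne_zero (α := F))
  refine AddChar.IsPrimitive.of_ne_one (AddChar.ne_one_iff.2 ⟨1 * b, fun h => hb ?_⟩)
  apply ZMod.injective_stdAddChar
  rw [AddChar.map_zero_eq_one]
  exact h

theorem eq_zero_of_forall_charE_mul_eq_one {x : F} (h : ∀ c, charE F (c * x) = 1) : x = 0 := by
  by_contra hx
  refine isPrimitive_addCharE hx (DFunLike.ext _ _ fun c => ?_)
  rw [AddChar.mulShift_apply, mul_comm, addCharE_apply, h, AddChar.one_apply]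

end FiniteFieldCharacter

section Laurent

variable {F : Type*} [Field F]

theorem toKInf_algebraMap (f : F[X]) : toKInf F (algebraMap F[X] (RatFunc F) f) = polyToKInf F f :=
  IsFractionRing.lift_algebraMap _ _

theorem polyToKInf_monomial (m : ℕ) (c : F) :
    polyToKInf F (Polynomial.monomial m c) = HahnSeries.single (-(m : ℤ)) c := by
  rw [polyToKInf, Polynomial.coe_eval₂RingHom, Polynomial.eval₂_monomial, tInf_pow,
    HahnSeries.C_apply, HahnSeries.single_mul_single, zero_add, mul_one]

theorem coeff_polyToKInf_of_pos (f : F[X]) {i : ℤ} (hi : 0 < i) : (polyToKInf F f).coeff i = 0 := by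
  induction f using Polynomial.induction_on' with
  | add p q hp hq => rw [map_add, HahnSeries.coeff_add, hp, hq, add_zero]
  | monomial m a => rw [polyToKInf_monomial, HahnSeries.coeff_single_of_ne (by lia)]

theorem polyToKInf_ne_zero {f : F[X]} (hf : f ≠ 0) : polyToKInf F f ≠ 0 :=
  (map_ne_zero_iff _ (polyToKInf_injective F)).2 hf

theorem order_polyToKInf (f : F[X]) : (polyToKInf F f).order = -(f.natDegree : ℤ) := by
  rcases eq_or_ne f 0 with rfl | hf
  · simp
  refine le_antisymm (HahnSeries.order_le_of_coeff_ne_zero ?_) ?_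
  · rw [coeff_polyToKInf]
    exact Polynomial.leadingCoeff_ne_zero.2 hf
  · refine HahnSeries.le_order_iff_forall (polyToKInf_ne_zero hf) |>.2 fun i hi => ?_
    obtain ⟨n, rfl⟩ : ∃ n : ℕ, i = -(n : ℤ) := ⟨(-i).toNat, by lia⟩
    rw [coeff_polyToKInf]
    exact Polynomial.coeff_eq_zero_of_natDegree_lt (by lia)

theorem leadingCoeff_polyToKInf (f : F[X]) :
    (polyToKInf F f).leadingCoeff = f.leadingCoeff := by
  rw [HahnSeries.leadingCoeff_eq, order_polyToKInf, coeff_polyToKInf, Polynomial.leadingCoeff]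

theorem absInf_polyToKInf {f : F[X]} (hf : f ≠ 0) :
    absInf F (polyToKInf F f) = (Nat.card F : ℝ) ^ f.natDegree := by
  rw [absInf, if_neg (polyToKInf_ne_zero hf), order_polyToKInf, neg_neg, zpow_natCast]

theorem exists_forall_coeff_polyToKInf_eq (x : KInf F) :
    ∃ f : F[X], ∀ i ≤ 0, (polyToKInf F f).coeff i = x.coeff i := by
  refine ⟨∑ n ∈ Finset.range ((-x.order).toNat + 1), Polynomial.monomial n (x.coeff (-(n : ℤ))),
    fun i hi => ?_⟩
  obtain ⟨n, rfl⟩ : ∃ n : ℕ, i = -(n : ℤ) := ⟨(-i).toNat, by lia⟩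
  simp only [coeff_polyToKInf, Polynomial.finsetSum_coeff, Polynomial.coeff_monomial,
    Finset.sum_ite_eq', Finset.mem_range]
  split_ifs with hn
  · rfl
  · exact (HahnSeries.coeff_eq_zero_of_lt_order (by lia)).symm

theorem orderTop_sub_le_min {x y : KInf F}
    (h : x.orderTop ≠ y.orderTop ∨ x.leadingCoeff ≠ y.leadingCoeff) :
    (x - y).orderTop ≤ min x.orderTop y.orderTop := by
  rcases lt_trichotomy x.orderTop y.orderTop with hlt | heq | hgt
  · rw [HahnSeries.orderTop_sub hlt]
    exact le_min le_rfl hlt.le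
  · have hlead := h.resolve_left (not_not.2 heq)
    rw [← heq, min_self]
    have hx : x ≠ 0 := by
      rintro rfl
      rw [HahnSeries.orderTop_zero, eq_comm, HahnSeries.orderTop_eq_top] at heq
      exact hlead (by rw [heq])
    have hy : y ≠ 0 := by
      rintro rfl
      exact hx (HahnSeries.orderTop_eq_top.1 (heq.trans HahnSeries.orderTop_zero))
    have horder : x.order = y.order := by
      simpa [← HahnSeries.order_eq_orderTop_of_ne_zero, hx, hy] using heq
    rw [← HahnSeries.order_eq_orderTop_of_ne_zero hx]
    apply HahnSeries.orderTop_le_of_coeff_ne_zero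
    rwa [HahnSeries.coeff_sub, sub_ne_zero, ← HahnSeries.leadingCoeff_eq, horder,
      ← HahnSeries.leadingCoeff_eq]
  · rw [← HahnSeries.orderTop_neg, neg_sub, HahnSeries.orderTop_sub hgt]
    exact le_min hgt.le le_rfl

/- If `a y²` had the order and the leading coefficient of `x²`, then `a` would have even order and a
square as its leading coefficient. -/
theorem orderTop_sq_sub_mul_sq_le {a : KInf F} (ha : Odd a.order ∨ ¬ IsSquare a.leadingCoeff)
    (x y : KInf F) :
    (x ^ 2 - a * y ^ 2).orderTop ≤ min (x ^ 2).orderTop (a * y ^ 2).orderTop := by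
  rcases eq_or_ne y 0 with rfl | hy
  · simp
  have ha0 : a ≠ 0 := by
    rintro rfl
    simp at ha
  apply orderTop_sub_le_min
  by_contra! h
  obtain ⟨horder, hlead⟩ := h
  rcases ha with hodd | hsq
  · have hx : x ≠ 0 := by
      rintro rfl
      simp [eq_comm, ha0, hy] at horder
    have : 2 * x.order = a.order + 2 * y.order := by
      rw [← HahnSeries.order_eq_orderTop_of_ne_zero (pow_ne_zero 2 hx),
        ← HahnSeries.order_eq_orderTop_of_ne_zero (mul_ne_zero ha0 (pow_ne_zero 2 hy)),
        WithTop.coe_inj, HahnSeries.order_mul ha0 (pow_ne_zero 2 hy), HahnSeries.order_pow,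
        HahnSeries.order_pow] at horder
      simpa using horder
    obtain ⟨m, hm⟩ := hodd
    lia
  · have hy' := HahnSeries.leadingCoeff_ne_zero.2 hy
    rw [HahnSeries.leadingCoeff_mul, sq, sq, HahnSeries.leadingCoeff_mul,
      HahnSeries.leadingCoeff_mul] at hlead
    refine hsq ⟨x.leadingCoeff / y.leadingCoeff, ?_⟩
    field_simp
    linear_combination -hlead

variable [Finite F]

theorem one_lt_natCard : (1 : ℝ) < Nat.card F := by exact_mod_cast Finite.one_lt_card

theorem one_le_natCard : (1 : ℝ) ≤ Nat.card F := one_lt_natCard.le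

theorem absInf_le_absInf {x y : KInf F} (h : y.orderTop ≤ x.orderTop) :
    absInf F x ≤ absInf F y := by
  rcases eq_or_ne x 0 with rfl | hx
  · rw [absInf, if_pos rfl, absInf]
    positivity
  have hy : y ≠ 0 := by
    rintro rfl
    rw [HahnSeries.orderTop_zero, top_le_iff, HahnSeries.orderTop_eq_top] at h
    exact hx h
  rw [← HahnSeries.order_eq_orderTop_of_ne_zero hx, ← HahnSeries.order_eq_orderTop_of_ne_zero hy,
    WithTop.coe_le_coe] at h
  rw [absInf, absInf, if_neg hx, if_neg hy]
  exact zpow_le_zpow_right₀ one_le_natCard (neg_le_neg h)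

theorem max_absInf_le_absInf_sq_sub_mul_sq {a : KInf F}
    (ha : Odd a.order ∨ ¬ IsSquare a.leadingCoeff) (x y : KInf F) :
    max (absInf F (x ^ 2)) (absInf F (a * y ^ 2)) ≤ absInf F (x ^ 2 - a * y ^ 2) :=
  have h := le_min_iff.1 (orderTop_sq_sub_mul_sq_le ha x y)
  max_le (absInf_le_absInf h.1) (absInf_le_absInf h.2)

theorem absInf_le_of_forall_coeff_eq_zero {x : KInf F} {J : ℤ} (h : ∀ i ≤ J, x.coeff i = 0) :
    absInf F x ≤ (Nat.card F : ℝ) ^ (-(J + 1)) := by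
  rw [absInf]
  split_ifs with hx
  · positivity
  · refine zpow_le_zpow_right₀ one_le_natCard (neg_le_neg ?_)
    exact HahnSeries.le_order_iff_forall hx |>.2 fun i hi => h i (by lia)

theorem exists_absInf_sub_polyToKInf_le {x : KInf F} {J : ℕ}
    (h : ∀ j < J, ∀ c, charInf F (polyToKInf F (Polynomial.monomial j c) * x) = 1) :
    ∃ f : F[X], absInf F (x - polyToKInf F f) ≤ (Nat.card F : ℝ) ^ (-((J : ℤ) + 1)) := by
  obtain ⟨f, hf⟩ := exists_forall_coeff_polyToKInf_eq x
  refine ⟨f, absInf_le_of_forall_coeff_eq_zero fun i hi => ?_⟩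
  rw [HahnSeries.coeff_sub]
  rcases le_or_gt i 0 with h0 | h0
  · rw [hf i h0, sub_self]
  · rw [coeff_polyToKInf_of_pos f h0, sub_zero]
    refine eq_zero_of_forall_charE_mul_eq_one fun c => ?_
    have := h (i - 1).toNat (by lia) c
    rwa [charInf, polyToKInf_monomial, HahnSeries.coeff_single_mul,
      show (1 : ℤ) - -((i - 1).toNat : ℤ) = i by lia] at this

variable (F) in
/-- The character `charInf` of `k_∞` as a bundled additive character. -/
noncomputable def addCharInf : AddChar (KInf F) ℂ where
  toFun := charInf F
  map_zero_eq_one' := by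
    rw [charInf, HahnSeries.coeff_zero, ← addCharE_apply, AddChar.map_zero_eq_one]
  map_add_eq_mul' x y := by
    simp only [charInf, HahnSeries.coeff_add, ← addCharE_apply, AddChar.map_add_eq_mul]

theorem addCharInf_apply (x : KInf F) : addCharInf F x = charInf F x := rfl

end Laurent

section LargeSieve

variable {G ι : Type*} [AddCommGroup G]

theorem sum_norm_sq_sum_mul_addChar [Fintype G] (b : G → ℂ) :
    ∑ ψ : AddChar G ℂ, ‖∑ g, b g * ψ g‖ ^ 2 = Fintype.card G * ∑ g, ‖b g‖ ^ 2 := by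
  classical
  have expand (ψ : AddChar G ℂ) : (∑ g, b g * ψ g) * (starRingEnd ℂ) (∑ g, b g * ψ g) =
      ∑ g, ∑ g', b g * (starRingEnd ℂ) (b g') * ψ (g - g') := by
    rw [map_sum, Finset.sum_mul_sum]
    refine Finset.sum_congr rfl fun g _ => Finset.sum_congr rfl fun g' _ => ?_
    rw [map_mul, sub_eq_add_neg, AddChar.map_add_eq_mul, AddChar.map_neg_eq_conj]
    ring
  have parseval : ∑ ψ : AddChar G ℂ, (∑ g, b g * ψ g) * (starRingEnd ℂ) (∑ g, b g * ψ g) =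
      Fintype.card G * ∑ g, b g * (starRingEnd ℂ) (b g) := by
    simp_rw [expand]
    rw [Finset.sum_comm, Finset.mul_sum]
    refine Finset.sum_congr rfl fun g _ => ?_
    rw [Finset.sum_comm]
    simp_rw [← Finset.mul_sum, AddChar.sum_apply_eq_ite, sub_eq_zero, mul_ite, mul_zero,
      Finset.sum_ite_eq, if_pos (Finset.mem_univ _)]
    ring
  simp only [Complex.mul_conj, Complex.normSq_eq_norm_sq] at parseval
  exact_mod_cast parseval

theorem sum_le_mul_sum_of_card_fiber_le {κ : Type*} [Fintype κ] [DecidableEq κ] (T : Finset ι)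
    (π : ι → κ) {M : ℕ} (hM : ∀ i ∈ T, {j ∈ T | π j = π i}.card ≤ M) {w : κ → ℝ}
    (hw : ∀ k, 0 ≤ w k) : ∑ i ∈ T, w (π i) ≤ M * ∑ k, w k := by
  calc ∑ i ∈ T, w (π i) = ∑ k ∈ T.image π, {j ∈ T | π j = k}.card • w k := Finset.sum_comp w π
    _ ≤ ∑ k ∈ T.image π, M * w k := by
        refine Finset.sum_le_sum fun k hk => ?_
        obtain ⟨i, hi, rfl⟩ := Finset.mem_image.1 hk
        rw [nsmul_eq_mul]
        exact mul_le_mul_of_nonneg_right (Nat.cast_le.2 (hM i hi)) (hw _)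
    _ ≤ M * ∑ k, w k := by
        rw [← Finset.mul_sum]
        exact mul_le_mul_of_nonneg_left (Finset.sum_le_univ_sum_of_nonneg hw) M.cast_nonneg

theorem sum_coe_ite_mem {α M : Type*} [DecidableEq α] [AddCommMonoid M] {H : Set α} [Fintype H]
    {B : Finset α} (hB : (B : Set α) ⊆ H) (c : α → M) :
    ∑ g : H, (if (g : α) ∈ B then c g else 0) = ∑ g ∈ B, c g := by
  rw [Finset.sum_set_coe H (f := fun g => if g ∈ B then c g else 0), Finset.sum_ite_mem,
    Finset.inter_eq_right.2 (Set.subset_toFinset.2 hB)]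

theorem sum_norm_sq_sum_mul_addChar_le (H : AddSubgroup G) [Finite H] (T : Finset ι)
    (ψ : ι → AddChar G ℂ) {M : ℕ}
    (hM : ∀ i ∈ T, {j ∈ (T : Set ι) | ∀ g ∈ H, ψ j g = ψ i g}.ncard ≤ M)
    {B : Finset G} (hB : (B : Set G) ⊆ H) (a : G → ℂ) :
    ∑ i ∈ T, ‖∑ g ∈ B, a g * ψ i g‖ ^ 2 ≤ M * (Nat.card H * ∑ g ∈ B, ‖a g‖ ^ 2) := by
  classical
  have := Fintype.ofFinite H
  let b : H → ℂ := fun g => if (g : G) ∈ B then a g else 0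
  let χ : ι → AddChar H ℂ := fun i => (ψ i).compAddMonoidHom H.subtype
  have sum_b (i : ι) : ∑ g, b g * χ i g = ∑ g ∈ B, a g * ψ i g := by
    rw [← sum_coe_ite_mem hB]
    exact Finset.sum_congr rfl fun g _ => ite_zero_mul ..
  have sum_norm_b : ∑ g, ‖b g‖ ^ 2 = ∑ g ∈ B, ‖a g‖ ^ 2 := by
    rw [← sum_coe_ite_mem hB]
    refine Finset.sum_congr rfl fun g _ => ?_
    dsimp only [b]
    split_ifs <;> simp
  have hfiber : ∀ i ∈ T, {j ∈ T | χ j = χ i}.card ≤ M := by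
    intro i hi
    convert hM i hi
    rw [← Set.ncard_coe_finset]
    congr 1
    ext j
    simp [χ, DFunLike.ext_iff]
  have := sum_le_mul_sum_of_card_fiber_le T χ hfiber
    (w := fun χ => ‖∑ g, b g * χ g‖ ^ 2) fun _ => by positivity
  simpa only [sum_norm_sq_sum_mul_addChar, sum_b, sum_norm_b, ← Nat.card_eq_fintype_card] using this

theorem finsum_mem_finsum_mem_eq_sum {κ M : Type*} [AddCommMonoid M] {A : Set ι} {S : ι → Set κ}
    (hfin : {p : ι × κ | p.1 ∈ A ∧ p.2 ∈ S p.1}.Finite) (c : ι → κ → M) :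
    ∑ᶠ i ∈ A, ∑ᶠ j ∈ S i, c i j = ∑ p ∈ hfin.toFinset, c p.1 p.2 := by
  rw [← finsum_mem_finset_eq_sum, finsum_mem_finset_product]
  refine finsum_congr fun i => ?_
  by_cases hi : i ∈ A <;> simp [hi]

end LargeSieve

theorem isIntegral_of_sq_eq {R A : Type*} [CommRing R] [Ring A] [Algebra R A] {a : R} {s : A}
    (hs : s ^ 2 = algebraMap R A a) : IsIntegral R s :=
  .of_pow two_pos (hs ▸ isIntegral_algebraMap)

section QuadraticExtension

variable {k K : Type*} [Field k] [Field K] [Algebra k K] {a : k} {s : K}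

theorem minpoly_eq_X_sq_sub_C (hs : s ^ 2 = algebraMap k K a)
    (hsk : s ∉ Set.range (algebraMap k K)) :
    minpoly k s = Polynomial.X ^ 2 - Polynomial.C a := by
  symm
  apply minpoly.eq_of_irreducible_of_monic
  · refine X_pow_sub_C_irreducible_of_prime Nat.prime_two fun r hr => hsk ?_
    rw [← hr, map_pow, sq_eq_sq_iff_eq_or_eq_neg] at hs
    rcases hs with hs | hs
    · exact ⟨r, hs.symm⟩
    · exact ⟨-r, by rw [map_neg, hs]⟩
  · simp [hs]
  · exact Polynomial.monic_X_pow_sub_C _ two_ne_zero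

theorem exists_eq_add_mul (hs : s ^ 2 = algebraMap k K a)
    (hK : IntermediateField.adjoin k {s} = ⊤) (x : K) :
    ∃ b c : k, x = algebraMap k K b + algebraMap k K c * s := by
  have hx : x ∈ Algebra.adjoin k {s} := by
    rw [← IntermediateField.adjoin_simple_toSubalgebra_of_isAlgebraic
      (isIntegral_of_sq_eq hs).isAlgebraic, hK]
    trivial
  induction hx using Algebra.adjoin_induction with
  | mem y hy => exact ⟨0, 1, by simp [Set.mem_singleton_iff.1 hy]⟩
  | algebraMap r => exact ⟨r, 0, by simp⟩
  | add y z _ _ hy hz =>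
    obtain ⟨b, c, rfl⟩ := hy
    obtain ⟨b', c', rfl⟩ := hz
    exact ⟨b + b', c + c', by simp only [map_add]; ring⟩
  | mul y z _ _ hy hz =>
    obtain ⟨b, c, rfl⟩ := hy
    obtain ⟨b', c', rfl⟩ := hz
    refine ⟨b * b' + c * c' * a, b * c' + c * b', ?_⟩
    simp only [map_add, map_mul, ← hs]
    ring

theorem finrank_eq_two (hs : s ^ 2 = algebraMap k K a) (hsk : s ∉ Set.range (algebraMap k K))
    (hK : IntermediateField.adjoin k {s} = ⊤) : Module.finrank k K = 2 := by
  rw [← IntermediateField.finrank_top', ← hK,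
    IntermediateField.adjoin.finrank (isIntegral_of_sq_eq hs), minpoly_eq_X_sq_sub_C hs hsk,
    Polynomial.natDegree_X_pow_sub_C]

theorem trace_sqrt (hs : s ^ 2 = algebraMap k K a) (hsk : s ∉ Set.range (algebraMap k K))
    (hK : IntermediateField.adjoin k {s} = ⊤) : Algebra.trace k K s = 0 := by
  have : FiniteDimensional k K :=
    .of_finrank_pos (by rw [finrank_eq_two hs hsk hK]; exact two_pos)
  rw [trace_eq_finrank_mul_minpoly_nextCoeff, minpoly_eq_X_sq_sub_C hs hsk,
    Polynomial.nextCoeff_of_natDegree_pos (by rw [Polynomial.natDegree_X_pow_sub_C]; exact two_pos),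
    Polynomial.natDegree_X_pow_sub_C]
  simp

theorem trace_add_mul (hs : s ^ 2 = algebraMap k K a) (hsk : s ∉ Set.range (algebraMap k K))
    (hK : IntermediateField.adjoin k {s} = ⊤) (b c : k) :
    Algebra.trace k K (algebraMap k K b + algebraMap k K c * s) = 2 * b := by
  rw [map_add, Algebra.trace_algebraMap, finrank_eq_two hs hsk hK, ← Algebra.smul_def, map_smul,
    trace_sqrt hs hsk hK, smul_zero, add_zero, nsmul_eq_mul, Nat.cast_ofNat]

theorem two_mul_sqrt_mul_eq (hs : s ^ 2 = algebraMap k K a)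
    (hsk : s ∉ Set.range (algebraMap k K)) (hK : IntermediateField.adjoin k {s} = ⊤) (x : K) :
    2 * s * x = algebraMap k K (Algebra.trace k K (s * x)) +
      algebraMap k K (Algebra.trace k K x) * s := by
  obtain ⟨b, c, rfl⟩ := exists_eq_add_mul hs hK x
  have hsx : s * (algebraMap k K b + algebraMap k K c * s) =
      algebraMap k K (c * a) + algebraMap k K b * s := by
    rw [map_mul, ← hs]
    ring
  rw [hsx, trace_add_mul hs hsk hK, trace_add_mul hs hsk hK]
  simp only [map_mul, map_ofNat, ← hs]
  ring

theorem two_mul_sq_eq (hs : s ^ 2 = algebraMap k K a)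
    (hsk : s ∉ Set.range (algebraMap k K)) (hK : IntermediateField.adjoin k {s} = ⊤) (x : K) :
    2 * x ^ 2 = algebraMap k K (2 * Algebra.trace k K x) * x +
      algebraMap k K (Algebra.trace k K (x ^ 2) - Algebra.trace k K x ^ 2) := by
  obtain ⟨b, c, rfl⟩ := exists_eq_add_mul hs hK x
  have hsq : (algebraMap k K b + algebraMap k K c * s) ^ 2 =
      algebraMap k K (b ^ 2 + c ^ 2 * a) + algebraMap k K (2 * b * c) * s := by
    simp only [map_add, map_mul, map_pow, map_ofNat, ← hs]
    ring
  rw [hsq, trace_add_mul hs hsk hK, trace_add_mul hs hsk hK]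
  simp only [map_add, map_sub, map_mul, map_pow, map_ofNat, ← hs]
  ring

end QuadraticExtension

theorem finite_degreeLT {F : Type*} [Field F] [Finite F] (n : ℕ) :
    (Polynomial.degreeLT F n : Set F[X]).Finite :=
  Set.finite_coe_iff.1 (Finite.of_equiv _ (Polynomial.degreeLTEquiv F n).toEquiv.symm)

theorem ncard_degreeLT {F : Type*} [Field F] (n : ℕ) :
    (Polynomial.degreeLT F n : Set F[X]).ncard = Nat.card F ^ n := by
  rw [← Nat.card_coe_set_eq]
  exact (Nat.card_congr (Polynomial.degreeLTEquiv F n).toEquiv).trans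
    (by rw [Nat.card_fun, Nat.card_fin])

section Characters

variable {F K : Type*} [Field F] [Field K] [Algebra F[X] K]

/-- The set `{g ∈ 𝔸 : N(g) ≤ q ^ N}` is an additive group when the absolute value `v` is
nonarchimedean. -/
def ballSubgroup {v : AbsoluteValue K ℝ} (hv : IsNonarchimedean v) (N : ℕ) :
    AddSubgroup (Integers F K) where
  carrier := ballInt F v N
  zero_mem' := by simp [ballInt, sizeN]
  add_mem' := by
    intro x y hx hy
    refine (pow_le_pow_left₀ (v.nonneg _) (hv x y) 2).trans ?_
    rcases max_choice (v (x : K)) (v (y : K)) with hm | hm <;> rw [hm]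
    exacts [hx, hy]
  neg_mem' := by
    intro x hx
    simpa [ballInt, sizeN] using hx

theorem mem_ballSubgroup {v : AbsoluteValue K ℝ} (hv : IsNonarchimedean v) {N : ℕ}
    {g : Integers F K} : g ∈ ballSubgroup hv N ↔ g ∈ ballInt F v N := Iff.rfl

variable [Algebra (RatFunc F) K] [Finite F]

/-- The character `g ↦ e(Tr(g y))` of the additive group of `𝔸`. -/
noncomputable def traceChar (y : K) : AddChar (Integers F K) ℂ where
  toFun g := charInf F (toKInf F (Algebra.trace (RatFunc F) K ((g : K) * y)))
  map_zero_eq_one' := by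
    simp only [ZeroMemClass.coe_zero, zero_mul, map_zero, ← addCharInf_apply,
      AddChar.map_zero_eq_one]
  map_add_eq_mul' g g' := by
    simp only [Subalgebra.coe_add, add_mul, map_add, ← addCharInf_apply, AddChar.map_add_eq_mul]

theorem traceChar_apply (y : K) (g : Integers F K) :
    traceChar y g = charInf F (toKInf F (Algebra.trace (RatFunc F) K ((g : K) * y))) := rfl

theorem traceChar_sub_apply (y z : K) (g : Integers F K) :
    traceChar (y - z) g = traceChar y g / traceChar z g := by
  simp only [traceChar_apply, mul_sub, map_sub, ← addCharInf_apply, AddChar.map_sub_eq_div]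

/-- The character `g ↦ e(Tr(g r / (2 s f)))` of the additive group of `𝔸`, used with `s = √α`. -/
noncomputable def fracChar (s : K) (f r : Integers F K) : AddChar (Integers F K) ℂ :=
  traceChar (r / (2 * s * f))

end Characters

theorem abs_mul_abs_of_mem_moduli {F K : Type*} [Field F] [Field K] [Algebra F[X] K]
    {v : AbsoluteValue K ℝ} {Q : ℕ} {f f' : Integers F K} (hf : f ∈ moduli F v Q)
    (hf' : f' ∈ moduli F v Q) : v f * v f' = (Nat.card F : ℝ) ^ Q := by
  have heq : v f = v f' :=
    (pow_left_inj₀ (v.nonneg _) (v.nonneg _) two_ne_zero).1 (hf.2.trans hf'.2.symm)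
  rw [heq, ← sq]
  exact hf'.2

theorem ballInt_mono {F K : Type*} [Field F] [Finite F] [Field K] [Algebra F[X] K]
    (v : AbsoluteValue K ℝ) : Monotone (ballInt F v) :=
  fun _ _ hmn _ hg => le_trans (b := _) hg (pow_le_pow_right₀ one_le_natCard hmn)

theorem pow_max_add_le {x : ℝ} (hx : 1 ≤ x) (m n d : ℕ) :
    x ^ max n (m + d) ≤ x ^ d * (x ^ m + x ^ n) := by
  have : 0 ≤ x := zero_le_one.trans hx
  rw [mul_add]
  rcases max_choice n (m + d) with hmax | hmax <;> rw [hmax]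
  · exact (le_mul_of_one_le_left (by positivity) (one_le_pow₀ hx)).trans
      (le_add_of_nonneg_left (by positivity))
  · rw [pow_add, mul_comm]
    exact le_add_of_nonneg_right (by positivity)

theorem dvd_of_mul_dvd_mul_sub_mul {R : Type*} [CommRing R] {f f' r r' : R} (hr : IsCoprime r f)
    (h : f * f' ∣ r * f' - r' * f) : f ∣ f' :=
  hr.symm.dvd_of_dvd_mul_left
    ((dvd_sub_left (Dvd.intro_left r' rfl)).1 ((Dvd.intro f' rfl).trans h))

section ReducedFractions

variable (F : Type*) {K : Type*} [Field F] [Field K] [Algebra F[X] K]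

/-- The reduced fractions `r / f` with `f ∈ 𝔸 ∖ {0}`, `N(f) = q ^ Q` and `r ∈ S f`, each encoded as
the pair `(f, r)`. -/
def reducedFractions (v : AbsoluteValue K ℝ) (S : Integers F K → Set (Integers F K)) (Q : ℕ) :
    Set (Integers F K × Integers F K) :=
  {p | p.1 ∈ moduli F v Q ∧ p.2 ∈ S p.1}

end ReducedFractions

/-- `K = k(√α)` is an imaginary quadratic extension of `k = F(t)` in odd characteristic, with
`s = √α`, and `v` is the absolute value of `K` that extends `|·|_∞`. -/
structure IsImaginaryQuadratic {F : Type*} [Field F] {K : Type*} [Field K] [Algebra F[X] K]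
    [Algebra (RatFunc F) K] (α : F[X]) (s : K) (v : AbsoluteValue K ℝ) : Prop where
  two_ne_zero : (2 : F) ≠ 0
  odd_or_not_isSquare : Odd α.natDegree ∨ ¬ IsSquare α.leadingCoeff
  sq_eq : s ^ 2 = algebraMap F[X] K α
  adjoin_eq_top : IntermediateField.adjoin (RatFunc F) {s} = ⊤
  abs_algebraMap : ∀ x : RatFunc F, v (algebraMap (RatFunc F) K x) = absInf F (toKInf F x)

theorem two_ne_zero_of_odd_natCard {F : Type*} [Field F] [Finite F] (hF : Odd (Nat.card F)) :
    (2 : F) ≠ 0 := by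
  have := Fintype.ofFinite F
  refine Ring.two_ne_zero fun hchar => ?_
  rw [Nat.card_eq_fintype_card, Nat.odd_iff, FiniteField.even_card_of_char_two hchar] at hF
  exact zero_ne_one hF

namespace IsImaginaryQuadratic

variable {F K : Type*} [Field F] [Field K] [Algebra F[X] K] [Algebra (RatFunc F) K] {α : F[X]}
  {s : K} {v : AbsoluteValue K ℝ}

theorem ne_zero (h : IsImaginaryQuadratic α s v) : α ≠ 0 := by
  rintro rfl
  simpa using h.odd_or_not_isSquare

theorem isIntegral_sqrt (h : IsImaginaryQuadratic α s v) : IsIntegral F[X] s :=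
  isIntegral_of_sq_eq h.sq_eq

theorem two_ne_zero_field (h : IsImaginaryQuadratic α s v) : (2 : K) ≠ 0 := by
  rw [← map_ofNat (algebraMap (RatFunc F) K) 2, ← map_ofNat (algebraMap F (RatFunc F)) 2,
    map_ne_zero, map_ne_zero]
  exact h.two_ne_zero

variable [IsScalarTower F[X] (RatFunc F) K]

theorem sq_eq_ratFunc (h : IsImaginaryQuadratic α s v) :
    s ^ 2 = algebraMap (RatFunc F) K (algebraMap F[X] (RatFunc F) α) := by
  rw [h.sq_eq, IsScalarTower.algebraMap_apply F[X] (RatFunc F) K]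

theorem abs_poly (h : IsImaginaryQuadratic α s v) {f : F[X]} (hf : f ≠ 0) :
    v (algebraMap F[X] K f) = (Nat.card F : ℝ) ^ f.natDegree := by
  rw [IsScalarTower.algebraMap_apply F[X] (RatFunc F) K, h.abs_algebraMap, toKInf_algebraMap,
    absInf_polyToKInf hf]

theorem abs_sqrt_sq (h : IsImaginaryQuadratic α s v) :
    v s ^ 2 = (Nat.card F : ℝ) ^ α.natDegree := by
  rw [← map_pow, h.sq_eq, h.abs_poly h.ne_zero]

theorem abs_natCast_le_one (h : IsImaginaryQuadratic α s v) (n : ℕ) : v (n : K) ≤ 1 := by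
  rw [← map_natCast (algebraMap F[X] K)]
  rcases eq_or_ne (n : F[X]) 0 with hn | hn
  · simp [hn]
  · rw [h.abs_poly hn, Polynomial.natDegree_natCast, pow_zero]

theorem isNonarchimedean (h : IsImaginaryQuadratic α s v) : IsNonarchimedean v := by
  let _ : NormedField K := v.toNormedField
  have : IsUltrametricDist K :=
    IsUltrametricDist.isUltrametricDist_of_forall_norm_natCast_le_one h.abs_natCast_le_one
  exact IsUltrametricDist.norm_add_le_max

variable [Finite F]

theorem one_le_abs_poly (h : IsImaginaryQuadratic α s v) {f : F[X]} (hf : f ≠ 0) :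
    1 ≤ v (algebraMap F[X] K f) := by
  rw [h.abs_poly hf]
  exact one_le_pow₀ one_le_natCard

theorem one_le_abs_sqrt (h : IsImaginaryQuadratic α s v) : 1 ≤ v s := by
  rw [← one_le_sq_iff₀ (v.nonneg s), h.abs_sqrt_sq]
  exact one_le_pow₀ one_le_natCard

theorem abs_sqrt_le (h : IsImaginaryQuadratic α s v) : v s ≤ (Nat.card F : ℝ) ^ α.natDegree :=
  h.abs_sqrt_sq ▸ le_self_pow₀ h.one_le_abs_sqrt _root_.two_ne_zero

theorem sqrt_ne_zero (h : IsImaginaryQuadratic α s v) : s ≠ 0 :=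
  v.pos_iff.1 (one_pos.trans_le h.one_le_abs_sqrt)

theorem two_mul_sqrt_ne_zero (h : IsImaginaryQuadratic α s v) : 2 * s ≠ 0 :=
  mul_ne_zero h.two_ne_zero_field h.sqrt_ne_zero

theorem max_abs_sq_le_abs_mul (h : IsImaginaryQuadratic α s v) (b c : RatFunc F) :
    max (v (algebraMap (RatFunc F) K b)) (v (algebraMap (RatFunc F) K c * s)) ^ 2 ≤
      v (algebraMap (RatFunc F) K b + algebraMap (RatFunc F) K c * s) *
        v (algebraMap (RatFunc F) K b - algebraMap (RatFunc F) K c * s) := by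
  have hα : Odd (polyToKInf F α).order ∨ ¬ IsSquare (polyToKInf F α).leadingCoeff := by
    rw [order_polyToKInf, leadingCoeff_polyToKInf, odd_neg, Int.odd_coe_nat]
    exact h.odd_or_not_isSquare
  have hmax := max_absInf_le_absInf_sq_sub_mul_sq hα (toKInf F b) (toKInf F c)
  simp only [← toKInf_algebraMap, ← map_pow, ← map_mul, ← map_sub, ← h.abs_algebraMap] at hmax
  have hprod : algebraMap (RatFunc F) K (b ^ 2 - algebraMap F[X] (RatFunc F) α * c ^ 2) =
      (algebraMap (RatFunc F) K b + algebraMap (RatFunc F) K c * s) *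
        (algebraMap (RatFunc F) K b - algebraMap (RatFunc F) K c * s) := by
    simp only [map_sub, map_mul, map_pow, ← h.sq_eq_ratFunc]
    ring
  have hcs : algebraMap (RatFunc F) K (algebraMap F[X] (RatFunc F) α * c ^ 2) =
      (algebraMap (RatFunc F) K c * s) ^ 2 := by
    rw [map_mul, map_pow, ← h.sq_eq_ratFunc]
    ring
  rw [hprod, hcs, map_mul, map_pow, map_pow, map_pow] at hmax
  rcases max_choice (v (algebraMap (RatFunc F) K b)) (v (algebraMap (RatFunc F) K c * s))
    with hm | hm <;> rw [hm]
  · exact (le_max_left _ _).trans hmax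
  · exact (le_max_right _ _).trans hmax

theorem max_abs_le_abs_add_mul (h : IsImaginaryQuadratic α s v) (b c : RatFunc F) :
    max (v (algebraMap (RatFunc F) K b)) (v (algebraMap (RatFunc F) K c * s)) ≤
      v (algebraMap (RatFunc F) K b + algebraMap (RatFunc F) K c * s) := by
  set m := max (v (algebraMap (RatFunc F) K b)) (v (algebraMap (RatFunc F) K c * s))
  have hm0 : 0 ≤ m := le_max_of_le_left (v.nonneg _)
  rcases hm0.eq_or_lt with hm | hm
  · rw [← hm]
    exact v.nonneg _
  · have hconj : v (algebraMap (RatFunc F) K b - algebraMap (RatFunc F) K c * s) ≤ m := by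
      simpa only [sub_eq_add_neg, v.map_neg] using
        h.isNonarchimedean (algebraMap (RatFunc F) K b) (-(algebraMap (RatFunc F) K c * s))
    refine le_of_mul_le_mul_right ?_ hm
    rw [← sq]
    exact (h.max_abs_sq_le_abs_mul b c).trans (mul_le_mul_of_nonneg_left hconj (v.nonneg _))

theorem sqrt_notMem_range (h : IsImaginaryQuadratic α s v) :
    s ∉ Set.range (algebraMap (RatFunc F) K) := by
  rintro ⟨r, hr⟩
  have := (le_max_right _ _).trans (h.max_abs_le_abs_add_mul (-r) 1)
  rw [map_neg, hr, map_one, one_mul, neg_add_cancel, map_zero] at this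
  exact (one_pos.trans_le h.one_le_abs_sqrt).not_ge this

theorem abs_trace_le (h : IsImaginaryQuadratic α s v) (x : K) :
    v (algebraMap (RatFunc F) K (Algebra.trace (RatFunc F) K x)) ≤ v x := by
  obtain ⟨b, c, rfl⟩ := exists_eq_add_mul h.sq_eq_ratFunc h.adjoin_eq_top x
  rw [trace_add_mul h.sq_eq_ratFunc h.sqrt_notMem_range h.adjoin_eq_top, map_mul, map_ofNat,
    map_mul]
  refine (mul_le_of_le_one_left (v.nonneg _) ?_).trans
    ((le_max_left _ _).trans (h.max_abs_le_abs_add_mul b c))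
  exact_mod_cast h.abs_natCast_le_one 2

theorem finiteDimensional (h : IsImaginaryQuadratic α s v) : FiniteDimensional (RatFunc F) K :=
  .of_finrank_pos
    (by rw [finrank_eq_two h.sq_eq_ratFunc h.sqrt_notMem_range h.adjoin_eq_top]; exact two_pos)

theorem exists_algebraMap_eq_trace (h : IsImaginaryQuadratic α s v) {x : K}
    (hx : IsIntegral F[X] x) :
    ∃ f : F[X], algebraMap F[X] (RatFunc F) f = Algebra.trace (RatFunc F) K x :=
  have := h.finiteDimensional
  IsIntegrallyClosed.isIntegral_iff.1 (Algebra.isIntegral_trace hx)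

theorem trace_eq_zero_of_abs_lt_one (h : IsImaginaryQuadratic α s v) {x : K}
    (hx : IsIntegral F[X] x) (hx1 : v x < 1) : Algebra.trace (RatFunc F) K x = 0 := by
  obtain ⟨f, hf⟩ := h.exists_algebraMap_eq_trace hx
  have hf1 : v (algebraMap F[X] K f) < 1 := by
    rw [IsScalarTower.algebraMap_apply F[X] (RatFunc F) K, hf]
    exact (h.abs_trace_le x).trans_lt hx1
  have : f = 0 := by
    by_contra hf0
    exact hf1.not_ge (h.one_le_abs_poly hf0)
  rw [← hf, this, map_zero]

theorem one_le_abs (h : IsImaginaryQuadratic α s v) {x : K} (hx : IsIntegral F[X] x)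
    (hx0 : x ≠ 0) : 1 ≤ v x := by
  by_contra! hlt
  have htr := h.trace_eq_zero_of_abs_lt_one hx hlt
  have htr_sq : Algebra.trace (RatFunc F) K (x ^ 2) = 0 := by
    refine h.trace_eq_zero_of_abs_lt_one (hx.pow 2) ?_
    rw [map_pow]
    exact pow_lt_one₀ (v.nonneg x) hlt _root_.two_ne_zero
  have hsq : 2 * x ^ 2 = 0 := by
    simpa [htr, htr_sq] using
      two_mul_sq_eq h.sq_eq_ratFunc h.sqrt_notMem_range h.adjoin_eq_top x
  exact mul_ne_zero h.two_ne_zero_field (pow_ne_zero 2 hx0) hsq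

theorem trace_mem_image_degreeLT (h : IsImaginaryQuadratic α s v) {x : K}
    (hx : IsIntegral F[X] x) {n : ℕ} (hxn : v x ^ 2 ≤ (Nat.card F : ℝ) ^ n) :
    Algebra.trace (RatFunc F) K x ∈
      algebraMap F[X] (RatFunc F) '' Polynomial.degreeLT F (n / 2 + 1) := by
  obtain ⟨f, hf⟩ := h.exists_algebraMap_eq_trace hx
  refine ⟨f, ?_, hf⟩
  rcases eq_or_ne f 0 with rfl | hf0
  · exact Submodule.zero_mem _
  have habs := pow_le_pow_left₀ (v.nonneg _) (h.abs_trace_le x) 2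
  rw [← hf, ← IsScalarTower.algebraMap_apply, h.abs_poly hf0, ← pow_mul] at habs
  have hdeg := (pow_le_pow_iff_right₀ one_lt_natCard).1 (habs.trans hxn)
  rw [SetLike.mem_coe, Polynomial.mem_degreeLT, Polynomial.degree_eq_natDegree hf0]
  exact_mod_cast (by lia : f.natDegree < n / 2 + 1)

theorem mapsTo_trace_ballInt (h : IsImaginaryQuadratic α s v) (N : ℕ) :
    Set.MapsTo
      (fun g : Integers F K => (Algebra.trace (RatFunc F) K g, Algebra.trace (RatFunc F) K (s * g)))
      (ballInt F v N)
      ((algebraMap F[X] (RatFunc F) '' Polynomial.degreeLT F (N / 2 + 1)) ×ˢ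
        (algebraMap F[X] (RatFunc F) '' Polynomial.degreeLT F ((α.natDegree + N) / 2 + 1))) := by
  refine fun g hg => ⟨h.trace_mem_image_degreeLT g.2 hg,
    h.trace_mem_image_degreeLT (h.isIntegral_sqrt.mul g.2) ?_⟩
  rw [map_mul, mul_pow, h.abs_sqrt_sq, pow_add]
  exact mul_le_mul_of_nonneg_left hg (by positivity)

theorem injective_trace (h : IsImaginaryQuadratic α s v) : Function.Injective
    (fun g : Integers F K =>
      (Algebra.trace (RatFunc F) K g, Algebra.trace (RatFunc F) K (s * g))) := by
  intro g g' hgg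
  obtain ⟨htr, htr_sqrt⟩ := Prod.mk.inj hgg
  have key := two_mul_sqrt_mul_eq h.sq_eq_ratFunc h.sqrt_notMem_range h.adjoin_eq_top
  refine Subtype.ext (mul_left_cancel₀ h.two_mul_sqrt_ne_zero ?_)
  rw [key, key (g' : K), htr, htr_sqrt]

theorem finite_ballInt (h : IsImaginaryQuadratic α s v) (N : ℕ) : (ballInt F v N).Finite :=
  .of_injOn (h.mapsTo_trace_ballInt N) h.injective_trace.injOn
    (((finite_degreeLT _).image _).prod ((finite_degreeLT _).image _))

theorem ncard_ballInt_le (h : IsImaginaryQuadratic α s v) (N : ℕ) :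
    (ballInt F v N).ncard ≤ Nat.card F ^ (α.natDegree + N + 2) :=
  calc (ballInt F v N).ncard
      ≤ _ := Set.ncard_le_ncard_of_injOn _ (h.mapsTo_trace_ballInt N) h.injective_trace.injOn
        (((finite_degreeLT _).image _).prod ((finite_degreeLT _).image _))
    _ = _ := Set.ncard_prod
    _ ≤ Nat.card F ^ (N / 2 + 1) * Nat.card F ^ ((α.natDegree + N) / 2 + 1) := by
        rw [← ncard_degreeLT, ← ncard_degreeLT]
        exact Nat.mul_le_mul (Set.ncard_image_le (finite_degreeLT _))
          (Set.ncard_image_le (finite_degreeLT _))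
    _ ≤ Nat.card F ^ (α.natDegree + N + 2) := by
        rw [← pow_add]
        exact Nat.pow_le_pow_right Nat.card_pos (by lia)

theorem finite_moduli (h : IsImaginaryQuadratic α s v) (Q : ℕ) : (moduli F v Q).Finite :=
  (h.finite_ballInt Q).subset fun _ hf => hf.2.le

theorem monomial_mul_mem_ballInt (h : IsImaginaryQuadratic α s v) {j J m : ℕ} (hj : j < J) (c : F)
    {y : Integers F K} (hy : y ∈ ballInt F v m) :
    algebraMap F[X] (Integers F K) (Polynomial.monomial j c) * y ∈ ballInt F v (2 * J + m) := by
  change v (algebraMap F[X] K (Polynomial.monomial j c) * y) ^ 2 ≤ _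
  have hmon : v (algebraMap F[X] K (Polynomial.monomial j c)) ^ 2 ≤ (Nat.card F : ℝ) ^ (2 * J) := by
    rcases eq_or_ne c 0 with rfl | hc
    · simp
    · rw [h.abs_poly (by simpa using hc), ← pow_mul, Polynomial.natDegree_monomial_eq _ hc]
      exact pow_le_pow_right₀ one_le_natCard (by lia)
  rw [map_mul, mul_pow, pow_add]
  exact mul_le_mul hmon hy (by positivity) (by positivity)

theorem exists_abs_trace_sub_le (h : IsImaginaryQuadratic α s v) {J m : ℕ} {y : Integers F K}
    (hy : y ∈ ballInt F v m) {z : K} (hz : ∀ g ∈ ballInt F v (2 * J + m), traceChar z g = 1) :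
    ∃ f : F[X], v (algebraMap (RatFunc F) K (Algebra.trace (RatFunc F) K (y * z)) -
      algebraMap F[X] K f) ≤ (Nat.card F : ℝ) ^ (-((J : ℤ) + 1)) := by
  have hchar : ∀ j < J, ∀ c, charInf F (polyToKInf F (Polynomial.monomial j c) *
      toKInf F (Algebra.trace (RatFunc F) K (y * z))) = 1 := fun j hj c => by
    have hj := hz _ (h.monomial_mul_mem_ballInt hj c hy)
    rw [traceChar_apply, Subalgebra.coe_mul, Subalgebra.coe_algebraMap] at hj
    rwa [← toKInf_algebraMap, ← map_mul, ← smul_eq_mul, ← map_smul, Algebra.smul_def,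
      ← IsScalarTower.algebraMap_apply, ← mul_assoc]
  obtain ⟨f, hf⟩ := exists_absInf_sub_polyToKInf_le hchar
  refine ⟨f, ?_⟩
  rwa [IsScalarTower.algebraMap_apply F[X] (RatFunc F) K, ← map_sub, h.abs_algebraMap, map_sub,
    toKInf_algebraMap]

/- Testing the character on `c t ^ j` and on `c t ^ j √α` shows that both coordinates of `2 √α z` in
the basis `1, √α` are close to polynomials. -/
theorem exists_abs_two_mul_sqrt_mul_sub_le (h : IsImaginaryQuadratic α s v) {J : ℕ} {z : K}
    (hz : ∀ g ∈ ballInt F v (2 * J + α.natDegree), traceChar z g = 1) :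
    ∃ w : Integers F K, v (2 * s * z - w) ≤ (Nat.card F : ℝ) ^ (-((J : ℤ) + 1)) * v s := by
  let sInt : Integers F K := ⟨s, h.isIntegral_sqrt⟩
  have one_mem : (1 : Integers F K) ∈ ballInt F v α.natDegree := by
    simpa [ballInt, sizeN] using one_le_pow₀ one_le_natCard
  obtain ⟨f, hf⟩ := h.exists_abs_trace_sub_le one_mem hz
  obtain ⟨f', hf'⟩ := h.exists_abs_trace_sub_le (y := sInt) h.abs_sqrt_sq.le hz
  rw [OneMemClass.coe_one, one_mul] at hf
  refine ⟨algebraMap F[X] (Integers F K) f' + algebraMap F[X] (Integers F K) f * sInt, ?_⟩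
  have hsub : 2 * s * z - (algebraMap F[X] K f' + algebraMap F[X] K f * s) =
      (algebraMap (RatFunc F) K (Algebra.trace (RatFunc F) K (s * z)) - algebraMap F[X] K f') +
        (algebraMap (RatFunc F) K (Algebra.trace (RatFunc F) K z) - algebraMap F[X] K f) * s := by
    rw [two_mul_sqrt_mul_eq h.sq_eq_ratFunc h.sqrt_notMem_range h.adjoin_eq_top]
    ring
  change v (2 * s * z - (algebraMap F[X] K f' + algebraMap F[X] K f * s)) ≤ _
  rw [hsub]
  refine (h.isNonarchimedean _ _).trans (max_le ?_ ?_)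
  · exact hf'.trans (le_mul_of_one_le_right (by positivity) h.one_le_abs_sqrt)
  · rw [map_mul]
    exact mul_le_mul_of_nonneg_right hf (v.nonneg s)

/- A nonzero integral element has absolute value at least `1`, whereas
`r f' - r' f - w f f' = f f' (r / f - r' / f' - w)` is small for the approximation `w` to
`r / f - r' / f'`. -/
theorem mul_dvd_mul_sub_mul (h : IsImaginaryQuadratic α s v) {Q N : ℕ}
    (hN : 2 * Q + 3 * α.natDegree ≤ N) {f f' r r' : Integers F K} (hf : f ∈ moduli F v Q)
    (hf' : f' ∈ moduli F v Q) (hψ : ∀ g ∈ ballInt F v N, fracChar s f r g = fracChar s f' r' g) :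
    f * f' ∣ r * f' - r' * f := by
  have hf0 : (f : K) ≠ 0 := by simpa using hf.1
  have hf0' : (f' : K) ≠ 0 := by simpa using hf'.1
  have hs := h.sqrt_ne_zero
  have h2 := h.two_ne_zero_field
  have htriv : ∀ g ∈ ballInt F v (2 * (Q + α.natDegree) + α.natDegree),
      traceChar (r / (2 * s * f) - r' / (2 * s * f') : K) g = 1 := fun g hg => by
    rw [traceChar_sub_apply, ← fracChar, ← fracChar, hψ g (ballInt_mono v (by lia) hg),
      div_self (AddChar.val_isUnit _ g).ne_zero]
  obtain ⟨w, hw⟩ := h.exists_abs_two_mul_sqrt_mul_sub_le (J := Q + α.natDegree) htriv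
  refine ⟨w, sub_eq_zero.1 ?_⟩
  by_contra hne
  refine (h.one_le_abs (r * f' - r' * f - f * f' * w).2 fun e => hne (Subtype.ext e)).not_gt ?_
  have hmul : ((r * f' - r' * f - f * f' * w : Integers F K) : K) =
      f * f' * (2 * s * (r / (2 * s * f) - r' / (2 * s * f')) - w) := by
    push_cast
    field_simp
  rw [hmul, map_mul, map_mul, abs_mul_abs_of_mem_moduli hf hf']
  calc (Nat.card F : ℝ) ^ Q * v (2 * s * (r / (2 * s * f) - r' / (2 * s * f')) - w)
      ≤ (Nat.card F : ℝ) ^ Q * ((Nat.card F : ℝ) ^ (-(((Q + α.natDegree : ℕ) : ℤ) + 1)) *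
          (Nat.card F : ℝ) ^ α.natDegree) := by
        gcongr
        exact hw.trans (mul_le_mul_of_nonneg_left h.abs_sqrt_le (by positivity))
    _ = (Nat.card F : ℝ)⁻¹ := by
        have hq : (Nat.card F : ℝ) ≠ 0 := (one_pos.trans one_lt_natCard).ne'
        rw [← zpow_natCast, ← zpow_natCast, ← zpow_add₀ hq, ← zpow_add₀ hq, ← zpow_neg_one]
        congr 1
        push_cast
        ring
    _ < 1 := inv_lt_one_of_one_lt₀ one_lt_natCard

theorem eq_of_fracChar_eq (h : IsImaginaryQuadratic α s v) {Q N : ℕ}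
    (hN : 2 * Q + 3 * α.natDegree ≤ N) {f r r' : Integers F K} {S : Set (Integers F K)}
    (hS : IsReducedResidueSystem f S) (hf : f ∈ moduli F v Q) (hr : r ∈ S) (hr' : r' ∈ S)
    (hψ : ∀ g ∈ ballInt F v N, fracChar s f r g = fracChar s f r' g) : r = r' := by
  have hdvd : f ∣ r - r' := by
    have := h.mul_dvd_mul_sub_mul hN hf hf hψ
    rwa [← sub_mul, mul_dvd_mul_iff_right hf.1] at this
  exact (hS.2 r (hS.1 r hr)).unique ⟨hr, by simp⟩ ⟨hr', hdvd⟩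

theorem finite_ballSubgroup (h : IsImaginaryQuadratic α s v) (N : ℕ) :
    Finite (ballSubgroup (F := F) h.isNonarchimedean N) :=
  Set.finite_coe_iff.2 (h.finite_ballInt N)

theorem natCard_ballSubgroup_le (h : IsImaginaryQuadratic α s v) (N : ℕ) :
    Nat.card (ballSubgroup (F := F) h.isNonarchimedean N) ≤
      Nat.card F ^ (α.natDegree + N + 2) :=
  (Nat.card_coe_set_eq _).trans_le (h.ncard_ballInt_le N)

theorem finite_of_isReducedResidueSystem (h : IsImaginaryQuadratic α s v) {Q : ℕ}
    {f : Integers F K} {S : Set (Integers F K)} (hS : IsReducedResidueSystem f S)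
    (hf : f ∈ moduli F v Q) : S.Finite := by
  let H := ballSubgroup (F := F) h.isNonarchimedean (2 * Q + 3 * α.natDegree)
  have : Finite H := h.finite_ballSubgroup _
  refine .of_injOn (f := fun r => (fracChar s f r).compAddMonoidHom H.subtype)
    (Set.mapsTo_univ _ _) (fun r hr r' hr' hψ => ?_) Set.finite_univ
  exact h.eq_of_fracChar_eq le_rfl hS hf hr hr' fun g hg => DFunLike.congr_fun hψ (⟨g, hg⟩ : H)

variable {S : Integers F K → Set (Integers F K)}

theorem finite_reducedFractions (h : IsImaginaryQuadratic α s v)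
    (hS : ∀ f, f ≠ 0 → IsReducedResidueSystem f (S f)) (Q : ℕ) :
    (reducedFractions F v S Q).Finite := by
  refine ((h.finite_moduli Q).biUnion fun f hf => ((h.finite_of_isReducedResidueSystem
    (hS f hf.1) hf).image (Prod.mk f))).subset fun p hp => ?_
  exact Set.mem_biUnion hp.1 ⟨p.2, hp.2, rfl⟩

/- The denominator of `p` divides that of `p'`, the quotient has absolute value `1`, and it
determines `p'`. -/
theorem ncard_fracChar_eq_le (h : IsImaginaryQuadratic α s v)
    (hS : ∀ f, f ≠ 0 → IsReducedResidueSystem f (S f)) {Q N : ℕ}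
    (hN : 2 * Q + 3 * α.natDegree ≤ N) {p : Integers F K × Integers F K}
    (hp : p ∈ reducedFractions F v S Q) :
    {p' ∈ reducedFractions F v S Q | ∀ g ∈ ballInt F v N,
      fracChar s p'.1 p'.2 g = fracChar s p.1 p.2 g}.ncard ≤ Nat.card F ^ (α.natDegree + 2) := by
  have hdvd : ∀ p' ∈ {p' ∈ reducedFractions F v S Q | ∀ g ∈ ballInt F v N,
      fracChar s p'.1 p'.2 g = fracChar s p.1 p.2 g}, p.1 ∣ p'.1 := fun p' hp' =>
    dvd_of_mul_dvd_mul_sub_mul ((hS _ hp.1.1).1 _ hp.2)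
      (h.mul_dvd_mul_sub_mul hN hp.1 hp'.1.1 fun g hg => (hp'.2 g hg).symm)
  choose! u hu using hdvd
  refine (Set.ncard_le_ncard_of_injOn u ?_ ?_ (h.finite_ballInt 0)).trans (h.ncard_ballInt_le 0)
  · intro p' hp'
    have hv : v p.1 ^ 2 * v (u p') ^ 2 = v p.1 ^ 2 := by
      rw [← mul_pow, ← map_mul, ← Subalgebra.coe_mul, ← hu p' hp']
      exact hp'.1.1.2.trans hp.1.2.symm
    have hf0 : v p.1 ^ 2 ≠ 0 := pow_ne_zero 2 (v.ne_zero (by simpa using hp.1.1))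
    exact ((mul_eq_left₀ hf0).1 hv).trans_le (pow_zero _).ge
  · rintro ⟨f₁, r₁⟩ h₁ ⟨f₂, r₂⟩ h₂ h₁₂
    obtain rfl : f₁ = f₂ := (hu _ h₁).trans ((congrArg (p.1 * ·) h₁₂).trans (hu _ h₂).symm)
    exact congrArg (Prod.mk f₁) (h.eq_of_fracChar_eq hN (hS f₁ h₁.1.1.1) h₁.1.1 h₁.1.2 h₂.1.2
      fun g hg => (h₁.2 g hg).trans (h₂.2 g hg).symm)

theorem sum_reducedFractions_norm_sq_le (h : IsImaginaryQuadratic α s v)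
    (hS : ∀ f, f ≠ 0 → IsReducedResidueSystem f (S f)) (Q N : ℕ) (a : Integers F K → ℂ) :
    ∑ p ∈ (h.finite_reducedFractions hS Q).toFinset,
        ‖∑ g ∈ (h.finite_ballInt N).toFinset, a g * fracChar s p.1 p.2 g‖ ^ 2 ≤
      (Nat.card F : ℝ) ^ (5 * α.natDegree + 4) *
        ((Nat.card F : ℝ) ^ (2 * Q) + (Nat.card F : ℝ) ^ N) *
        ∑ g ∈ (h.finite_ballInt N).toFinset, ‖a g‖ ^ 2 := by
  let N' := max N (2 * Q + 3 * α.natDegree)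
  let H := ballSubgroup (F := F) h.isNonarchimedean N'
  have : Finite H := h.finite_ballSubgroup N'
  have hBH : ((h.finite_ballInt N).toFinset : Set (Integers F K)) ⊆ H := by
    rw [Set.Finite.coe_toFinset]
    exact fun g hg => (mem_ballSubgroup _).2 (ballInt_mono v (le_max_left _ _) hg)
  have hmult : ∀ p ∈ (h.finite_reducedFractions hS Q).toFinset,
      {p' ∈ ((h.finite_reducedFractions hS Q).toFinset : Set (Integers F K × Integers F K)) |
        ∀ g ∈ H, fracChar s p'.1 p'.2 g = fracChar s p.1 p.2 g}.ncard ≤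
      Nat.card F ^ (α.natDegree + 2) := fun p hp => by
    simp only [Set.Finite.coe_toFinset, H, mem_ballSubgroup]
    exact h.ncard_fracChar_eq_le hS (le_max_right _ _) ((Set.Finite.mem_toFinset _).1 hp)
  have hcard : (Nat.card H : ℝ) ≤ (Nat.card F : ℝ) ^ (α.natDegree + N' + 2) := by
    exact_mod_cast h.natCard_ballSubgroup_le N'
  refine (sum_norm_sq_sum_mul_addChar_le H (h.finite_reducedFractions hS Q).toFinset
    (fun p => fracChar s p.1 p.2) hmult hBH a).trans ?_
  rw [← mul_assoc]
  refine mul_le_mul_of_nonneg_right ?_ (by positivity)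
  calc ((Nat.card F ^ (α.natDegree + 2) : ℕ) : ℝ) * Nat.card H
      ≤ (Nat.card F : ℝ) ^ (α.natDegree + 2) * (Nat.card F : ℝ) ^ (α.natDegree + N' + 2) := by
        push_cast
        gcongr
    _ = (Nat.card F : ℝ) ^ (2 * α.natDegree + 4) * (Nat.card F : ℝ) ^ N' := by ring
    _ ≤ (Nat.card F : ℝ) ^ (2 * α.natDegree + 4) * ((Nat.card F : ℝ) ^ (3 * α.natDegree) *
        ((Nat.card F : ℝ) ^ (2 * Q) + (Nat.card F : ℝ) ^ N)) := by
        gcongr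
        exact pow_max_add_le one_le_natCard _ _ _
    _ = _ := by ring

end IsImaginaryQuadratic

end QuadLargeSieve

open QuadLargeSieve in
theorem theorem1_general {F : Type*} [Field F] [Finite F] {α : F[X]} {K : Type*} [Field K]
    [Algebra F[X] K] [Algebra (RatFunc F) K] [IsScalarTower F[X] (RatFunc F) K] {s : K}
    {v : AbsoluteValue K ℝ} (h : IsImaginaryQuadratic α s v)
    {S : Integers F K → Set (Integers F K)}
    (hS : ∀ f : Integers F K, f ≠ 0 → IsReducedResidueSystem f (S f))
    (Q N : ℕ) (a : Integers F K → ℂ) :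
    (moduli F v Q).Finite ∧ (∀ f ∈ moduli F v Q, (S f).Finite) ∧ (ballInt F v N).Finite ∧
    ∑ᶠ f ∈ moduli F v Q, ∑ᶠ r ∈ S f,
        ‖∑ᶠ g ∈ ballInt F v N, a g * charInf F (toKInf F
          (Algebra.trace (RatFunc F) K ((g : K) * (r : K) / (2 * s * (f : K)))))‖ ^ 2 ≤
      (Nat.card F : ℝ) ^ (5 * α.natDegree + 4) *
        ((Nat.card F : ℝ) ^ (2 * Q) + (Nat.card F : ℝ) ^ N) *
        ∑ᶠ g ∈ ballInt F v N, ‖a g‖ ^ 2 := by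
  refine ⟨h.finite_moduli Q, fun f hf => h.finite_of_isReducedResidueSystem (hS f hf.1) hf,
    h.finite_ballInt N, ?_⟩
  rw [finsum_mem_finsum_mem_eq_sum (h.finite_reducedFractions hS Q)]
  simp only [finsum_mem_eq_finite_toFinset_sum _ (h.finite_ballInt N), mul_div_assoc]
  exact h.sum_reducedFractions_norm_sq_le hS Q N a

open QuadLargeSieve in
theorem theorem1 (q : ℕ) (hq : Odd q) (l : ℕ) :
    ∃ C : ℝ, 0 < C ∧
      ∀ (F : Type*) [Field F] [Finite F] (_hF : Nat.card F = q)
        (α : F[X]) (_hα : Squarefree α) (_hl : α.natDegree = l)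
        (_him : Odd α.natDegree ∨ ¬ IsSquare α.leadingCoeff)
        -- `K = k(√α)` with `k = F(t)`; `s` is `√α`
        (K : Type*) [Field K] [Algebra F[X] K] [Algebra (RatFunc F) K]
        [IsScalarTower F[X] (RatFunc F) K]
        (s : K) (_hs : s ^ 2 = algebraMap F[X] K α)
        (_hK : IntermediateField.adjoin (RatFunc F) {s} = ⊤)
        -- the absolute value of `K` at the fixed place above `∞`
        (v : AbsoluteValue K ℝ)
        (_hv : ∀ x : RatFunc F, v (algebraMap (RatFunc F) K x) = absInf F (toKInf F x))
        -- for each modulus `f`, representatives of the classes `r mod f` with `(r, f) = 1`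
        (S : Integers F K → Set (Integers F K))
        (_hS : ∀ f : Integers F K, f ≠ 0 → IsReducedResidueSystem f (S f))
        (Q N : ℕ) (a : Integers F K → ℂ),
        (moduli F v Q).Finite ∧ (∀ f ∈ moduli F v Q, (S f).Finite) ∧ (ballInt F v N).Finite ∧
        ∑ᶠ f ∈ moduli F v Q, ∑ᶠ r ∈ S f,
            ‖∑ᶠ g ∈ ballInt F v N, a g * charInf F (toKInf F
              (Algebra.trace (RatFunc F) K ((g : K) * (r : K) / (2 * s * (f : K)))))‖ ^ 2 ≤
          C * ((q : ℝ) ^ (2 * Q) + (q : ℝ) ^ N) * ∑ᶠ g ∈ ballInt F v N, ‖a g‖ ^ 2 := by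
  refine ⟨(q : ℝ) ^ (5 * l + 4), pow_pos (by exact_mod_cast hq.pos) _, ?_⟩
  rintro F _ _ rfl α - rfl him K _ _ _ _ s hs hK v hv S hS Q N a
  exact theorem1_general ⟨two_ne_zero_of_odd_natCard hq, him, hs, hK, hv⟩ hS Q N a
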